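/- Call a ring $R$ coherent if the category $\mathrm{mod}(R)$ of finitely presented right $R$-modules and the category $\mathrm{mod}(R^{op})$ of finitely presented left $R$-modules are both abelian. Let $\mathrm{Mod}(R)$ be the category of right $R$-modules; all functors are additive. A functor $F\colon\mathrm{Mod}(R)\to\mathrm{Ab}$ is totally finitely presented if there are $X,Y\in\mathrm{mod}(R)$ and an exact sequence of functors $\mathrm{Hom}_R(Y,-)\to\mathrm{Hom}_R(X,-)\to F\to 0$ (exact at every module); let $\mathrm{tfp}(\mathrm{Mod}(R),\mathrm{Ab})$ be the category of totally finitely presented functors and all natural transformations between them. For a functor $F\colon\mathrm{Mod}(R)\to\mathrm{Ab}$ and a module $X$ choose exact sequences $0\to X\to I\to\Sigma X\to 0$ with $I$ injective and $0\to\Omega X\to P\to X\to 0$ with $P$ projective. The right satellite $S^1F$ and the left satellite $S_1F$ are the functors determined by the exact sequences $$F(I)\to F(\Sigma X)\to S^1F(X)\to 0,\qquad 0\to S_1F(X)\to F(\Omega X)\to F(P);$$ up to isomorphism they do not depend on the choices, and they are functorial in $F$. Put $S^0F=S_0F=F$, and $S^n=S^1S^{n-1}$, $S_n=S_1S_{n-1}$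 for $n>0$. Theorem. Let $R$ be a coherent ring. For every $F\in\mathrm{tfp}(\mathrm{Mod}(R),\mathrm{Ab})$ and all $n\ge 0$: (1) $S^nF\in\mathrm{tfp}(\mathrm{Mod}(R),\mathrm{Ab})$; (2) $S_nF\in\mathrm{tfp}(\mathrm{Mod}(R),\mathrm{Ab})$. Moreover, for every $n\ge 0$ the endofunctors $S^n$ and $S_n$ of $\mathrm{tfp}(\mathrm{Mod}(R),\mathrm{Ab})$ so obtained form an adjoint pair $(S^n,S_n)$, with $S^n$ left adjoint to $S_n$. -/

import Mathlib

open CategoryTheory CategoryTheory.Limits Opposite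

universe u

noncomputable section

namespace Satellites

set_option linter.unusedSectionVars false

universe v v' u'

section RightSatellite

variable {C : Type u} [Category.{v} C] [Abelian C] [EnoughInjectives C]
variable {D : Type u'} [Category.{v'} D] [Abelian D]

/-- The cosyzygy `ΣX` in the chosen sequence `0 ⟶ X ⟶ I ⟶ ΣX ⟶ 0`, `I = Injective.under X`. -/
abbrev cosyzygy (X : C) : C := cokernel (Injective.ι X)

/-- The epimorphism `I ⟶ ΣX` of the chosen cosyzygy sequence of `X`. -/
abbrev cosyzygyπ (X : C) : Injective.under X ⟶ cosyzygy X := cokernel.π (Injective.ι X)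

/-- An extension of `f : X ⟶ Y` to the chosen injective objects. -/
def underMap {X Y : C} (f : X ⟶ Y) : Injective.under X ⟶ Injective.under Y :=
  Injective.factorThru (f ≫ Injective.ι Y) (Injective.ι X)

lemma ι_underMap {X Y : C} (f : X ⟶ Y) :
    Injective.ι X ≫ underMap f = f ≫ Injective.ι Y :=
  Injective.comp_factorThru _ _

/-- The map `ΣX ⟶ ΣY` induced by `f : X ⟶ Y`. -/
def cosyzygyMap {X Y : C} (f : X ⟶ Y) : cosyzygy X ⟶ cosyzygy Y :=
  cokernel.map _ _ f (underMap f) (ι_underMap f)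

lemma π_cosyzygyMap {X Y : C} (f : X ⟶ Y) :
    cosyzygyπ X ≫ cosyzygyMap f = underMap f ≫ cosyzygyπ Y :=
  cokernel.π_desc _ _ _

/-- Two maps of cosyzygy sequences that agree on the left differ, on the right, by a map that
factors through the injective object. -/
lemma exists_cosyzygy_factor {X Y : C} (f : X ⟶ Y) {a a' : Injective.under X ⟶ Injective.under Y}
    {c c' : cosyzygy X ⟶ cosyzygy Y}
    (ha : Injective.ι X ≫ a = f ≫ Injective.ι Y) (hc : cosyzygyπ X ≫ c = a ≫ cosyzygyπ Y)
    (ha' : Injective.ι X ≫ a' = f ≫ Injective.ι Y) (hc' : cosyzygyπ X ≫ c' = a' ≫ cosyzygyπ Y) :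
    ∃ h : cosyzygy X ⟶ Injective.under Y, c = c' + h ≫ cosyzygyπ Y := by
  have h0 : Injective.ι X ≫ (a - a') = 0 := by rw [Preadditive.comp_sub, ha, ha', sub_self]
  refine ⟨cokernel.desc _ (a - a') h0, ?_⟩
  rw [← cancel_epi (cosyzygyπ X), Preadditive.comp_add, hc, hc', cokernel.π_desc_assoc,
    Preadditive.sub_comp, add_sub_cancel]

/-- The value of the right satellite: `F(I) ⟶ F(ΣX) ⟶ S¹F(X) ⟶ 0` is exact. -/
def rightSatelliteObj (F : C ⥤ D) (X : C) : D := cokernel (F.map (cosyzygyπ X))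

/-- The projection `F(ΣX) ⟶ S¹F(X)`. -/
def rightSatelliteπ (F : C ⥤ D) (X : C) : F.obj (cosyzygy X) ⟶ rightSatelliteObj F X :=
  cokernel.π (F.map (cosyzygyπ X))

instance (F : C ⥤ D) (X : C) : Epi (rightSatelliteπ F X) :=
  inferInstanceAs (Epi (cokernel.π _))

lemma map_rightSatelliteπ (F : C ⥤ D) (X : C) :
    F.map (cosyzygyπ X) ≫ rightSatelliteπ F X = 0 :=
  cokernel.condition _

lemma map_rightSatelliteπ_eq (F : C ⥤ D) [F.Additive] {X Y : C} (f : X ⟶ Y)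
    {a a' : Injective.under X ⟶ Injective.under Y} {c c' : cosyzygy X ⟶ cosyzygy Y}
    (ha : Injective.ι X ≫ a = f ≫ Injective.ι Y) (hc : cosyzygyπ X ≫ c = a ≫ cosyzygyπ Y)
    (ha' : Injective.ι X ≫ a' = f ≫ Injective.ι Y) (hc' : cosyzygyπ X ≫ c' = a' ≫ cosyzygyπ Y) :
    F.map c ≫ rightSatelliteπ F Y = F.map c' ≫ rightSatelliteπ F Y := by
  obtain ⟨h, rfl⟩ := exists_cosyzygy_factor f ha hc ha' hc'
  rw [F.map_add, F.map_comp, Preadditive.add_comp, Category.assoc, map_rightSatelliteπ,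
    comp_zero, add_zero]

/-- The map `S¹F(X) ⟶ S¹F(Y)` induced by `f : X ⟶ Y`. -/
def rightSatelliteMap (F : C ⥤ D) {X Y : C} (f : X ⟶ Y) :
    rightSatelliteObj F X ⟶ rightSatelliteObj F Y :=
  cokernel.map _ _ (F.map (underMap f)) (F.map (cosyzygyMap f))
    (by rw [← F.map_comp, ← F.map_comp, π_cosyzygyMap])

lemma rightSatelliteπ_map (F : C ⥤ D) {X Y : C} (f : X ⟶ Y) :
    rightSatelliteπ F X ≫ rightSatelliteMap F f = F.map (cosyzygyMap f) ≫ rightSatelliteπ F Y :=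
  cokernel.π_desc _ _ _

/-- The first right satellite `S¹F` of an additive functor `F`. -/
def rightSatelliteFunctor (F : C ⥤ D) [F.Additive] : C ⥤ D where
  obj X := rightSatelliteObj F X
  map f := rightSatelliteMap F f
  map_id X := by
    rw [← cancel_epi (rightSatelliteπ F X), rightSatelliteπ_map, Category.comp_id]
    refine (map_rightSatelliteπ_eq F (𝟙 X) (a' := 𝟙 _) (c' := 𝟙 _)
      (ι_underMap _) (π_cosyzygyMap _) (by simp) (by simp)).trans (by simp)
  map_comp {X Y Z} f g := by
    rw [← cancel_epi (rightSatelliteπ F X), ← Category.assoc, rightSatelliteπ_map,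
      rightSatelliteπ_map, Category.assoc, rightSatelliteπ_map, ← Category.assoc, ← F.map_comp]
    refine map_rightSatelliteπ_eq F (f ≫ g) (a' := underMap f ≫ underMap g)
      (ι_underMap _) (π_cosyzygyMap _) ?_ ?_
    · rw [← Category.assoc, ι_underMap, Category.assoc, ι_underMap, Category.assoc]
    · rw [← Category.assoc, π_cosyzygyMap, Category.assoc, π_cosyzygyMap, Category.assoc]

instance (F : C ⥤ D) [F.Additive] : (rightSatelliteFunctor F).Additive where
  map_add {X Y f g} := by
    change rightSatelliteMap F (f + g) = rightSatelliteMap F f + rightSatelliteMap F g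
    rw [← cancel_epi (rightSatelliteπ F X), Preadditive.comp_add, rightSatelliteπ_map,
      rightSatelliteπ_map, rightSatelliteπ_map, ← Preadditive.add_comp, ← F.map_add]
    refine map_rightSatelliteπ_eq F (f + g) (a' := underMap f + underMap g)
      (ι_underMap _) (π_cosyzygyMap _) ?_ ?_
    · rw [Preadditive.comp_add, ι_underMap, ι_underMap, Preadditive.add_comp]
    · rw [Preadditive.comp_add, π_cosyzygyMap, π_cosyzygyMap, Preadditive.add_comp]

/-- The component `S¹F(X) ⟶ S¹G(X)` induced by `α : F ⟶ G`. -/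
def rightSatelliteApp {F G : C ⥤ D} (α : F ⟶ G) (X : C) :
    rightSatelliteObj F X ⟶ rightSatelliteObj G X :=
  cokernel.map _ _ (α.app _) (α.app _) (α.naturality (cosyzygyπ X))

lemma rightSatelliteπ_app {F G : C ⥤ D} (α : F ⟶ G) (X : C) :
    rightSatelliteπ F X ≫ rightSatelliteApp α X = α.app (cosyzygy X) ≫ rightSatelliteπ G X :=
  cokernel.π_desc _ _ _

/-- The natural transformation `S¹F ⟶ S¹G` induced by `α : F ⟶ G`. -/
def rightSatelliteNatTrans {F G : C ⥤ D} [F.Additive] [G.Additive] (α : F ⟶ G) :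
    rightSatelliteFunctor F ⟶ rightSatelliteFunctor G where
  app X := rightSatelliteApp α X
  naturality X Y f := by
    change rightSatelliteMap F f ≫ rightSatelliteApp α Y =
      rightSatelliteApp α X ≫ rightSatelliteMap G f
    rw [← cancel_epi (rightSatelliteπ F X), ← Category.assoc, rightSatelliteπ_map,
      Category.assoc, rightSatelliteπ_app, ← Category.assoc _ (rightSatelliteApp α X),
      rightSatelliteπ_app, Category.assoc, rightSatelliteπ_map,
      ← Category.assoc, ← Category.assoc, α.naturality]

variable (C D)

/-- The first right satellite `S¹ : F ↦ S¹F` on the category of additive functors. -/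
def rightSatellite : (C ⥤+ D) ⥤ (C ⥤+ D) where
  obj F := AdditiveFunctor.of (rightSatelliteFunctor F.obj)
  map α := ObjectProperty.homMk (rightSatelliteNatTrans α.hom)
  map_id F := by
    ext X
    change rightSatelliteApp (𝟙 F.obj) X = 𝟙 (rightSatelliteObj F.obj X)
    rw [← cancel_epi (rightSatelliteπ F.obj X), rightSatelliteπ_app, Category.comp_id,
      NatTrans.id_app, Category.id_comp]
  map_comp {F G H} α β := by
    ext X
    change rightSatelliteApp (α.hom ≫ β.hom) X =
      rightSatelliteApp α.hom X ≫ rightSatelliteApp β.hom X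
    rw [← cancel_epi (rightSatelliteπ F.obj X), rightSatelliteπ_app, ← Category.assoc,
      rightSatelliteπ_app, Category.assoc, rightSatelliteπ_app, NatTrans.comp_app, Category.assoc]

/-- The iterated right satellite: `S⁰F = F` and `Sⁿ⁺¹F = S¹(SⁿF)`. -/
def rightSatelliteIter : ℕ → ((C ⥤+ D) ⥤ (C ⥤+ D))
  | 0 => 𝟭 _
  | n + 1 => rightSatelliteIter n ⋙ rightSatellite C D

end RightSatellite

section LeftSatellite

variable {C : Type u} [Category.{v} C] [Abelian C] [EnoughProjectives C]
variable {D : Type u'} [Category.{v'} D] [Abelian D]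

/-- The syzygy `ΩX` in the chosen sequence `0 ⟶ ΩX ⟶ P ⟶ X ⟶ 0`, `P = Projective.over X`. -/
abbrev syzygy (X : C) : C := kernel (Projective.π X)

/-- The monomorphism `ΩX ⟶ P` of the chosen syzygy sequence of `X`. -/
abbrev syzygyι (X : C) : syzygy X ⟶ Projective.over X := kernel.ι (Projective.π X)

/-- A lift of `f : X ⟶ Y` to the chosen projective objects. -/
def overMap {X Y : C} (f : X ⟶ Y) : Projective.over X ⟶ Projective.over Y :=
  Projective.factorThru (Projective.π X ≫ f) (Projective.π Y)

lemma overMap_π {X Y : C} (f : X ⟶ Y) :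
    overMap f ≫ Projective.π Y = Projective.π X ≫ f :=
  Projective.factorThru_comp _ _

/-- The map `ΩX ⟶ ΩY` induced by `f : X ⟶ Y`. -/
def syzygyMap {X Y : C} (f : X ⟶ Y) : syzygy X ⟶ syzygy Y :=
  kernel.map _ _ (overMap f) f (overMap_π f).symm

lemma syzygyMap_ι {X Y : C} (f : X ⟶ Y) :
    syzygyMap f ≫ syzygyι Y = syzygyι X ≫ overMap f :=
  kernel.lift_ι _ _ _

/-- Two maps of syzygy sequences that agree on the right differ, on the left, by a map that
factors through the projective object. -/
lemma exists_syzygy_factor {X Y : C} (f : X ⟶ Y) {a a' : Projective.over X ⟶ Projective.over Y}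
    {c c' : syzygy X ⟶ syzygy Y}
    (ha : a ≫ Projective.π Y = Projective.π X ≫ f) (hc : c ≫ syzygyι Y = syzygyι X ≫ a)
    (ha' : a' ≫ Projective.π Y = Projective.π X ≫ f) (hc' : c' ≫ syzygyι Y = syzygyι X ≫ a') :
    ∃ h : Projective.over X ⟶ syzygy Y, c = c' + syzygyι X ≫ h := by
  have h0 : (a - a') ≫ Projective.π Y = 0 := by rw [Preadditive.sub_comp, ha, ha', sub_self]
  refine ⟨kernel.lift _ (a - a') h0, ?_⟩
  rw [← cancel_mono (syzygyι Y), Preadditive.add_comp, hc, hc', Category.assoc, kernel.lift_ι,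
    Preadditive.comp_sub, add_sub_cancel]

/-- The value of the left satellite: `0 ⟶ S₁F(X) ⟶ F(ΩX) ⟶ F(P)` is exact. -/
def leftSatelliteObj (F : C ⥤ D) (X : C) : D := kernel (F.map (syzygyι X))

/-- The inclusion `S₁F(X) ⟶ F(ΩX)`. -/
def leftSatelliteι (F : C ⥤ D) (X : C) : leftSatelliteObj F X ⟶ F.obj (syzygy X) :=
  kernel.ι (F.map (syzygyι X))

instance (F : C ⥤ D) (X : C) : Mono (leftSatelliteι F X) :=
  inferInstanceAs (Mono (kernel.ι _))

lemma leftSatelliteι_map (F : C ⥤ D) (X : C) :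
    leftSatelliteι F X ≫ F.map (syzygyι X) = 0 :=
  kernel.condition _

lemma leftSatelliteι_map_eq (F : C ⥤ D) [F.Additive] {X Y : C} (f : X ⟶ Y)
    {a a' : Projective.over X ⟶ Projective.over Y} {c c' : syzygy X ⟶ syzygy Y}
    (ha : a ≫ Projective.π Y = Projective.π X ≫ f) (hc : c ≫ syzygyι Y = syzygyι X ≫ a)
    (ha' : a' ≫ Projective.π Y = Projective.π X ≫ f) (hc' : c' ≫ syzygyι Y = syzygyι X ≫ a') :
    leftSatelliteι F X ≫ F.map c = leftSatelliteι F X ≫ F.map c' := by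
  obtain ⟨h, rfl⟩ := exists_syzygy_factor f ha hc ha' hc'
  rw [F.map_add, F.map_comp, Preadditive.comp_add, ← Category.assoc _ (F.map (syzygyι X)),
    leftSatelliteι_map, zero_comp, add_zero]

/-- The map `S₁F(X) ⟶ S₁F(Y)` induced by `f : X ⟶ Y`. -/
def leftSatelliteMap (F : C ⥤ D) {X Y : C} (f : X ⟶ Y) :
    leftSatelliteObj F X ⟶ leftSatelliteObj F Y :=
  kernel.map _ _ (F.map (syzygyMap f)) (F.map (overMap f))
    (by rw [← F.map_comp, ← F.map_comp, syzygyMap_ι])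

lemma leftSatelliteMap_ι (F : C ⥤ D) {X Y : C} (f : X ⟶ Y) :
    leftSatelliteMap F f ≫ leftSatelliteι F Y = leftSatelliteι F X ≫ F.map (syzygyMap f) :=
  kernel.lift_ι _ _ _

/-- The first left satellite `S₁F` of an additive functor `F`. -/
def leftSatelliteFunctor (F : C ⥤ D) [F.Additive] : C ⥤ D where
  obj X := leftSatelliteObj F X
  map f := leftSatelliteMap F f
  map_id X := by
    rw [← cancel_mono (leftSatelliteι F X), leftSatelliteMap_ι, Category.id_comp]
    refine (leftSatelliteι_map_eq F (𝟙 X) (a' := 𝟙 _) (c' := 𝟙 _)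
      (overMap_π _) (syzygyMap_ι _) (by simp) (by simp)).trans (by simp)
  map_comp {X Y Z} f g := by
    rw [← cancel_mono (leftSatelliteι F Z), Category.assoc, leftSatelliteMap_ι,
      leftSatelliteMap_ι, ← Category.assoc, leftSatelliteMap_ι, Category.assoc, ← F.map_comp]
    refine leftSatelliteι_map_eq F (f ≫ g) (a' := overMap f ≫ overMap g)
      (overMap_π _) (syzygyMap_ι _) ?_ ?_
    · rw [Category.assoc, overMap_π, ← Category.assoc, overMap_π, Category.assoc]
    · rw [Category.assoc, syzygyMap_ι, ← Category.assoc, syzygyMap_ι, Category.assoc]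

instance (F : C ⥤ D) [F.Additive] : (leftSatelliteFunctor F).Additive where
  map_add {X Y f g} := by
    change leftSatelliteMap F (f + g) = leftSatelliteMap F f + leftSatelliteMap F g
    rw [← cancel_mono (leftSatelliteι F Y), Preadditive.add_comp, leftSatelliteMap_ι,
      leftSatelliteMap_ι, leftSatelliteMap_ι, ← Preadditive.comp_add, ← F.map_add]
    refine leftSatelliteι_map_eq F (f + g) (a' := overMap f + overMap g)
      (overMap_π _) (syzygyMap_ι _) ?_ ?_
    · rw [Preadditive.add_comp, overMap_π, overMap_π, Preadditive.comp_add]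
    · rw [Preadditive.add_comp, syzygyMap_ι, syzygyMap_ι, Preadditive.comp_add]

/-- The component `S₁F(X) ⟶ S₁G(X)` induced by `α : F ⟶ G`. -/
def leftSatelliteApp {F G : C ⥤ D} (α : F ⟶ G) (X : C) :
    leftSatelliteObj F X ⟶ leftSatelliteObj G X :=
  kernel.map _ _ (α.app _) (α.app _) (α.naturality (syzygyι X))

lemma leftSatelliteApp_ι {F G : C ⥤ D} (α : F ⟶ G) (X : C) :
    leftSatelliteApp α X ≫ leftSatelliteι G X = leftSatelliteι F X ≫ α.app (syzygy X) :=
  kernel.lift_ι _ _ _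

/-- The natural transformation `S₁F ⟶ S₁G` induced by `α : F ⟶ G`. -/
def leftSatelliteNatTrans {F G : C ⥤ D} [F.Additive] [G.Additive] (α : F ⟶ G) :
    leftSatelliteFunctor F ⟶ leftSatelliteFunctor G where
  app X := leftSatelliteApp α X
  naturality X Y f := by
    change leftSatelliteMap F f ≫ leftSatelliteApp α Y =
      leftSatelliteApp α X ≫ leftSatelliteMap G f
    rw [← cancel_mono (leftSatelliteι G Y), Category.assoc, Category.assoc, leftSatelliteMap_ι,
      leftSatelliteApp_ι, ← Category.assoc, leftSatelliteMap_ι, ← Category.assoc,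
      leftSatelliteApp_ι, Category.assoc, Category.assoc, α.naturality]

variable (C D)

/-- The first left satellite `S₁ : F ↦ S₁F` on the category of additive functors. -/
def leftSatellite : (C ⥤+ D) ⥤ (C ⥤+ D) where
  obj F := AdditiveFunctor.of (leftSatelliteFunctor F.obj)
  map α := ObjectProperty.homMk (leftSatelliteNatTrans α.hom)
  map_id F := by
    ext X
    change leftSatelliteApp (𝟙 F.obj) X = 𝟙 (leftSatelliteObj F.obj X)
    rw [← cancel_mono (leftSatelliteι F.obj X), leftSatelliteApp_ι, Category.id_comp,
      NatTrans.id_app, Category.comp_id]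
  map_comp {F G H} α β := by
    ext X
    change leftSatelliteApp (α.hom ≫ β.hom) X =
      leftSatelliteApp α.hom X ≫ leftSatelliteApp β.hom X
    rw [← cancel_mono (leftSatelliteι H.obj X), leftSatelliteApp_ι, Category.assoc,
      leftSatelliteApp_ι, ← Category.assoc, leftSatelliteApp_ι, NatTrans.comp_app, Category.assoc]

/-- The iterated left satellite: `S₀F = F` and `Sₙ₊₁F = S₁(SₙF)`. -/
def leftSatelliteIter : ℕ → ((C ⥤+ D) ⥤ (C ⥤+ D))
  | 0 => 𝟭 _
  | n + 1 => leftSatelliteIter n ⋙ leftSatellite C D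

end LeftSatellite

section TotallyFinitelyPresented

/-- Finitely presented (left) `A`-modules. Finitely presented right `R`-modules are the case
`A = Rᵐᵒᵖ`. -/
def finitelyPresentedModules (A : Type u) [Ring A] : ObjectProperty (ModuleCat.{u} A) :=
  fun M => Module.FinitePresentation A M

/-- A ring `R` is coherent if the category of finitely presented right `R`-modules and the
category of finitely presented left `R`-modules are both abelian. -/
def IsCoherentRing (R : Type u) [Ring R] : Prop :=
  Nonempty (Abelian (finitelyPresentedModules Rᵐᵒᵖ).FullSubcategory) ∧
    Nonempty (Abelian (finitelyPresentedModules R).FullSubcategory)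

/-- An additive functor `F` from `A`-modules to abelian groups is totally finitely presented if
there are finitely presented modules `X`, `Y` and an exact sequence of functors
`(Y, -) ⟶ (X, -) ⟶ F ⟶ 0`; exactness is exactness at every module `M`. -/
def tfp (A : Type u) [Ring A] : ObjectProperty (ModuleCat.{u} A ⥤+ AddCommGrpCat.{u}) :=
  fun F => ∃ X Y : ModuleCat.{u} A,
    finitelyPresentedModules A X ∧ finitelyPresentedModules A Y ∧
    ∃ (α : preadditiveCoyoneda.obj (op Y) ⟶ preadditiveCoyoneda.obj (op X))
      (π : preadditiveCoyoneda.obj (op X) ⟶ F.obj),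
      ∀ M : ModuleCat.{u} A,
        Function.Exact (α.app M) (π.app M) ∧ Function.Surjective (π.app M)

end TotallyFinitelyPresented

end Satellites

end

/-! The adjunction holds for all additive functors between abelian categories with enough injectives
and projectives in the source. Comparing the syzygy and cosyzygy sequences gives maps `ΩΣX ⟶ X` and
`X ⟶ ΣΩX`, hence connecting maps `F(X) ⟶ S¹F(ΩX)` and `S₁G(ΣX) ⟶ G(X)`. A map `S¹F ⟶ G` is
transposed to `F(X) ⟶ S¹F(ΩX) ⟶ G(ΩX)`, which lands in `S₁G(X)`; a map `F ⟶ S₁G` is transposed to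
`F(ΣX) ⟶ S₁G(ΣX) ⟶ G(X)`, which descends to `S¹F(X)`. Iterating `satelliteAdjunction` gives `Sⁿ ⊣
Sₙ`, and this restricts to the full subcategory `tfp` once both functors preserve it.

For preservation, let `F` be the cokernel of `(f, -)` with `f : X ⟶ Y` finitely presented. Right
coherence gives finitely presented syzygy sequences of `X` and `Y`, and dimension shifting shows
that `S¹F` is the cokernel of `(P ⊞ ΩY, -) ⟶ (ΩX, -)`, with `P` the projective cover term of `X`'s
sequence (`IsPresentation.rightSatellite`).

For `S₁F`, put `Z = coker f`. Then `S₁F(M)` consists of the maps `Z ⟶ M` whose composite with `Y ⟶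
Z` factors through a projective, modulo those that factor through a projective themselves. Left
coherence makes the dual of a finitely presented right module finitely generated, so `Y` and `Z`
have finitely presented left projective approximations `Y ⟶ Q` and `Z ⟶ Q'`. Factoring through a
projective then means factoring through these, and two pushouts, `W` of `Z` and `Q` under `Y`, then
`W'` of `W` and `Q'` under `Z`, give `S₁F` as the cokernel of `(W', -) ⟶ (W, -)`
(`IsPresentation.leftSatellite`). -/

noncomputable section

namespace Satellites

universe v v' u'

/-! ### Adjunction of the satellites on additive functors -/

section Adjunction

variable {C : Type u} [Category.{v} C] [Abelian C]
variable {D : Type u'} [Category.{v'} D] [Abelian D]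

section Right

variable [EnoughInjectives C]

/-- Two maps from a short exact sequence to the cosyzygy sequence of `M` which agree on the left
have the same image in the right satellite. -/
lemma map_comp_rightSatelliteπ_eq (F : C ⥤ D) [F.Additive] {S : ShortComplex C}
    (hS : S.ShortExact) {M : C} {e e' : S.X₂ ⟶ Injective.under M} {d d' : S.X₃ ⟶ cosyzygy M}
    (he : S.f ≫ e = S.f ≫ e') (hd : S.g ≫ d = e ≫ cosyzygyπ M)
    (hd' : S.g ≫ d' = e' ≫ cosyzygyπ M) :
    F.map d ≫ rightSatelliteπ F M = F.map d' ≫ rightSatelliteπ F M := by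
  have := hS.epi_g
  have h0 : S.f ≫ (e - e') = 0 := by rw [Preadditive.comp_sub, he, sub_self]
  have : d = d' + hS.exact.desc _ h0 ≫ cosyzygyπ M := by
    rw [← cancel_epi S.g, Preadditive.comp_add, hd, hd', hS.exact.g_desc_assoc,
      Preadditive.sub_comp, add_sub_cancel]
  rw [this, F.map_add, F.map_comp, Preadditive.add_comp, Category.assoc, map_rightSatelliteπ,
    comp_zero, add_zero]

/-- Every map `S.X₁ ⟶ M` extends to a map from the short exact sequence `S` to the cosyzygy
sequence of `M`. -/
lemma exists_map_cosyzygy {S : ShortComplex C} (hS : S.ShortExact) {M : C} (a : S.X₁ ⟶ M) :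
    ∃ (e : S.X₂ ⟶ Injective.under M) (d : S.X₃ ⟶ cosyzygy M),
      S.f ≫ e = a ≫ Injective.ι M ∧ S.g ≫ d = e ≫ cosyzygyπ M := by
  have := hS.mono_f
  have := hS.epi_g
  have he := Injective.comp_factorThru (a ≫ Injective.ι M) S.f
  refine ⟨Injective.factorThru (a ≫ Injective.ι M) S.f, hS.exact.desc
    (Injective.factorThru (a ≫ Injective.ι M) S.f ≫ cosyzygyπ M) ?_, he, hS.exact.g_desc _ _⟩
  rw [reassoc_of% he, cokernel.condition, comp_zero]

lemma cosyzygy_shortExact (X : C) :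
    (ShortComplex.mk (Injective.ι X) (cosyzygyπ X) (cokernel.condition _)).ShortExact where
  exact := ShortComplex.exact_of_g_is_cokernel _ (cokernelIsCokernel _)

/-- The components of a natural transformation out of a right satellite. -/
def ofRightSatelliteApp {F G : C ⥤ D} [F.Additive] (θ : rightSatelliteFunctor F ⟶ G) (X : C) :
    rightSatelliteObj F X ⟶ G.obj X :=
  θ.app X

lemma ofRightSatelliteApp_naturality {F G : C ⥤ D} [F.Additive] (θ : rightSatelliteFunctor F ⟶ G)
    {X Y : C} (f : X ⟶ Y) :
    rightSatelliteMap F f ≫ ofRightSatelliteApp θ Y = ofRightSatelliteApp θ X ≫ G.map f :=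
  θ.naturality f

end Right

section Left

variable [EnoughProjectives C]

/-- Two maps from the syzygy sequence of `M` to a short exact sequence which agree on the right
have the same restriction to the left satellite. -/
lemma leftSatelliteι_comp_map_eq (G : C ⥤ D) [G.Additive] {S : ShortComplex C}
    (hS : S.ShortExact) {M : C} {e e' : Projective.over M ⟶ S.X₂} {c c' : syzygy M ⟶ S.X₁}
    (he : e ≫ S.g = e' ≫ S.g) (hc : c ≫ S.f = syzygyι M ≫ e)
    (hc' : c' ≫ S.f = syzygyι M ≫ e') :
    leftSatelliteι G M ≫ G.map c = leftSatelliteι G M ≫ G.map c' := by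
  have := hS.mono_f
  have h0 : (e - e') ≫ S.g = 0 := by rw [Preadditive.sub_comp, he, sub_self]
  have : c = c' + syzygyι M ≫ hS.exact.lift _ h0 := by
    rw [← cancel_mono S.f, Preadditive.add_comp, hc, hc', Category.assoc, hS.exact.lift_f,
      Preadditive.comp_sub, add_sub_cancel]
  rw [this, G.map_add, G.map_comp, Preadditive.comp_add, ← Category.assoc _ (G.map (syzygyι M)),
    leftSatelliteι_map, zero_comp, add_zero]

/-- Every map `M ⟶ S.X₃` extends to a map from the syzygy sequence of `M` to the short exact
sequence `S`. -/
lemma exists_map_syzygy {S : ShortComplex C} (hS : S.ShortExact) {M : C} (a : M ⟶ S.X₃) :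
    ∃ (e : Projective.over M ⟶ S.X₂) (c : syzygy M ⟶ S.X₁),
      e ≫ S.g = Projective.π M ≫ a ∧ c ≫ S.f = syzygyι M ≫ e := by
  have := hS.mono_f
  have := hS.epi_g
  have he := Projective.factorThru_comp (Projective.π M ≫ a) S.g
  refine ⟨Projective.factorThru (Projective.π M ≫ a) S.g, hS.exact.lift
    (syzygyι M ≫ Projective.factorThru (Projective.π M ≫ a) S.g) ?_, he, hS.exact.lift_f _ _⟩
  rw [Category.assoc, he, kernel.condition_assoc, zero_comp]

lemma syzygy_shortExact (X : C) :
    (ShortComplex.mk (syzygyι X) (Projective.π X) (kernel.condition _)).ShortExact where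
  exact := ShortComplex.exact_of_f_is_kernel _ (kernelIsKernel _)

/-- The components of a natural transformation into a left satellite. -/
def toLeftSatelliteApp {F G : C ⥤ D} [G.Additive] (η : F ⟶ leftSatelliteFunctor G) (X : C) :
    F.obj X ⟶ leftSatelliteObj G X :=
  η.app X

lemma toLeftSatelliteApp_naturality {F G : C ⥤ D} [G.Additive] (η : F ⟶ leftSatelliteFunctor G)
    {X Y : C} (f : X ⟶ Y) :
    F.map f ≫ toLeftSatelliteApp η Y = toLeftSatelliteApp η X ≫ leftSatelliteMap G f :=
  η.naturality f

end Left

variable [EnoughInjectives C] [EnoughProjectives C]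

/-- Injectivity extends the identity of `ΩX` to a map of sequences. The extension is not unique, but
by `map_comp_rightSatelliteπ_eq` the choice is invisible in the right satellite. -/
lemma exists_comparison (X : C) :
    ∃ (e : Projective.over X ⟶ Injective.under (syzygy X)) (d : X ⟶ cosyzygy (syzygy X)),
      syzygyι X ≫ e = Injective.ι (syzygy X) ∧
        Projective.π X ≫ d = e ≫ cosyzygyπ (syzygy X) := by
  simpa using exists_map_cosyzygy (syzygy_shortExact X) (𝟙 _)

lemma exists_comparison' (X : C) :
    ∃ (e : Projective.over (cosyzygy X) ⟶ Injective.under X) (c : syzygy (cosyzygy X) ⟶ X),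
      e ≫ cosyzygyπ X = Projective.π (cosyzygy X) ∧
        c ≫ Injective.ι X = syzygyι (cosyzygy X) ≫ e := by
  simpa using exists_map_syzygy (cosyzygy_shortExact X) (𝟙 _)

/-- The connecting map `X ⟶ ΣΩX`. -/
def toCosyzygySyzygy (X : C) : X ⟶ cosyzygy (syzygy X) := (exists_comparison X).choose_spec.choose

/-- The connecting map `ΩΣX ⟶ X`. -/
def ofSyzygyCosyzygy (X : C) : syzygy (cosyzygy X) ⟶ X := (exists_comparison' X).choose_spec.choose

lemma toCosyzygySyzygy_spec (X : C) :
    ∃ e : Projective.over X ⟶ Injective.under (syzygy X),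
      syzygyι X ≫ e = Injective.ι (syzygy X) ∧
        Projective.π X ≫ toCosyzygySyzygy X = e ≫ cosyzygyπ (syzygy X) :=
  ⟨_, (exists_comparison X).choose_spec.choose_spec⟩

lemma ofSyzygyCosyzygy_spec (X : C) :
    ∃ e : Projective.over (cosyzygy X) ⟶ Injective.under X,
      e ≫ cosyzygyπ X = Projective.π (cosyzygy X) ∧
        ofSyzygyCosyzygy X ≫ Injective.ι X = syzygyι (cosyzygy X) ≫ e :=
  ⟨_, (exists_comparison' X).choose_spec.choose_spec⟩

/-- The connecting map `F(X) ⟶ S¹F(ΩX)`. -/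
def rightConnecting (F : C ⥤ D) (X : C) : F.obj X ⟶ rightSatelliteObj F (syzygy X) :=
  F.map (toCosyzygySyzygy X) ≫ rightSatelliteπ F (syzygy X)

/-- The connecting map `S₁G(ΣX) ⟶ G(X)`. -/
def leftConnecting (G : C ⥤ D) (X : C) : leftSatelliteObj G (cosyzygy X) ⟶ G.obj X :=
  leftSatelliteι G (cosyzygy X) ≫ G.map (ofSyzygyCosyzygy X)

lemma rightConnecting_naturality (F : C ⥤ D) [F.Additive] {X Y : C} (f : X ⟶ Y) :
    F.map f ≫ rightConnecting F Y = rightConnecting F X ≫ rightSatelliteMap F (syzygyMap f) := by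
  obtain ⟨e, he, hd⟩ := toCosyzygySyzygy_spec X
  obtain ⟨e', he', hd'⟩ := toCosyzygySyzygy_spec Y
  rw [rightConnecting, rightConnecting, Category.assoc, rightSatelliteπ_map, ← F.map_comp_assoc,
    ← F.map_comp_assoc]
  refine map_comp_rightSatelliteπ_eq F (syzygy_shortExact X) (e := overMap f ≫ e')
    (e' := e ≫ underMap (syzygyMap f)) ?_ ?_ ?_
  · dsimp
    rw [← Category.assoc, ← syzygyMap_ι, Category.assoc, he', reassoc_of% he, ι_underMap]
  · dsimp
    rw [← Category.assoc, ← overMap_π, Category.assoc, hd', Category.assoc]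
  · dsimp
    rw [reassoc_of% hd, π_cosyzygyMap, Category.assoc]

lemma leftConnecting_naturality (G : C ⥤ D) [G.Additive] {X Y : C} (f : X ⟶ Y) :
    leftSatelliteMap G (cosyzygyMap f) ≫ leftConnecting G Y = leftConnecting G X ≫ G.map f := by
  obtain ⟨e, he, hc⟩ := ofSyzygyCosyzygy_spec X
  obtain ⟨e', he', hc'⟩ := ofSyzygyCosyzygy_spec Y
  rw [leftConnecting, leftConnecting, ← Category.assoc, leftSatelliteMap_ι, Category.assoc,
    Category.assoc, ← G.map_comp, ← G.map_comp]
  refine leftSatelliteι_comp_map_eq G (cosyzygy_shortExact Y)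
    (e := overMap (cosyzygyMap f) ≫ e') (e' := e ≫ underMap f) ?_ ?_ ?_
  · dsimp
    rw [Category.assoc, he', overMap_π, Category.assoc, ← π_cosyzygyMap, reassoc_of% he]
  · dsimp
    rw [Category.assoc, hc', ← Category.assoc, syzygyMap_ι, Category.assoc]
  · dsimp
    rw [Category.assoc, ← ι_underMap, reassoc_of% hc]

/-- The inclusion `ΩX ⟶ P` extends to the identity of `P`, so the induced map of sequences can be
replaced by one that is zero on the right. This is what makes the transpose land in the kernel
`S₁G(X)`. -/
lemma rightConnecting_map_syzygyι (F : C ⥤ D) [F.Additive] (X : C) :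
    rightConnecting F X ≫ rightSatelliteMap F (syzygyι X) = 0 := by
  obtain ⟨e, he, hd⟩ := toCosyzygySyzygy_spec X
  rw [rightConnecting, Category.assoc, rightSatelliteπ_map, ← F.map_comp_assoc]
  refine (map_comp_rightSatelliteπ_eq F (syzygy_shortExact X) (d' := 0)
    (e := e ≫ underMap (syzygyι X)) (e' := Injective.ι _) ?_ ?_ ?_).trans (by simp)
  · dsimp
    rw [reassoc_of% he, ι_underMap]
  · dsimp
    rw [reassoc_of% hd, π_cosyzygyMap, Category.assoc]
  · simp

/-- Dually, `I ⟶ ΣX` lifts through the identity of `I`. This is what lets the inverse transpose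
descend to the cokernel `S¹F(X)`. -/
lemma map_cosyzygyπ_leftConnecting (G : C ⥤ D) [G.Additive] (X : C) :
    leftSatelliteMap G (cosyzygyπ X) ≫ leftConnecting G X = 0 := by
  obtain ⟨e, he, hc⟩ := ofSyzygyCosyzygy_spec X
  rw [leftConnecting, ← Category.assoc, leftSatelliteMap_ι, Category.assoc, ← G.map_comp]
  refine (leftSatelliteι_comp_map_eq G (cosyzygy_shortExact X) (c' := 0)
    (e := overMap (cosyzygyπ X) ≫ e) (e' := Projective.π _) ?_ ?_ ?_).trans (by simp)
  · dsimp
    rw [Category.assoc, he, overMap_π]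
  · dsimp
    rw [Category.assoc, hc, ← Category.assoc, syzygyMap_ι, Category.assoc]
  · simp

/-- The components of the transpose `F ⟶ S₁G` of `θ : S¹F ⟶ G`. -/
def satelliteTransposeApp {F G : C ⥤ D} [F.Additive] (θ : rightSatelliteFunctor F ⟶ G) (X : C) :
    F.obj X ⟶ leftSatelliteObj G X :=
  kernel.lift (G.map (syzygyι X)) (rightConnecting F X ≫ ofRightSatelliteApp θ (syzygy X)) (by
    rw [Category.assoc, ← ofRightSatelliteApp_naturality, ← Category.assoc,
      rightConnecting_map_syzygyι, zero_comp])

lemma satelliteTransposeApp_ι {F G : C ⥤ D} [F.Additive]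
    (θ : rightSatelliteFunctor F ⟶ G) (X : C) :
    satelliteTransposeApp θ X ≫ leftSatelliteι G X =
      rightConnecting F X ≫ ofRightSatelliteApp θ (syzygy X) :=
  kernel.lift_ι _ _ _

/-- The transpose `F ⟶ S₁G` of `θ : S¹F ⟶ G`. -/
def satelliteTranspose {F G : C ⥤ D} [F.Additive] [G.Additive] (θ : rightSatelliteFunctor F ⟶ G) :
    F ⟶ leftSatelliteFunctor G where
  app X := satelliteTransposeApp θ X
  naturality X Y f := by
    change F.map f ≫ satelliteTransposeApp θ Y = satelliteTransposeApp θ X ≫ leftSatelliteMap G f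
    rw [← cancel_mono (leftSatelliteι G Y), Category.assoc, Category.assoc, leftSatelliteMap_ι,
      satelliteTransposeApp_ι, ← Category.assoc (satelliteTransposeApp θ X),
      satelliteTransposeApp_ι, ← Category.assoc, rightConnecting_naturality,
      Category.assoc, Category.assoc, ofRightSatelliteApp_naturality]

/-- The components of the transpose `S¹F ⟶ G` of `η : F ⟶ S₁G`. -/
def satelliteTransposeInvApp {F G : C ⥤ D} [G.Additive]
    (η : F ⟶ leftSatelliteFunctor G) (X : C) : rightSatelliteObj F X ⟶ G.obj X :=
  cokernel.desc (F.map (cosyzygyπ X)) (toLeftSatelliteApp η (cosyzygy X) ≫ leftConnecting G X) (by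
    rw [← Category.assoc, toLeftSatelliteApp_naturality, Category.assoc,
      map_cosyzygyπ_leftConnecting, comp_zero])

lemma π_satelliteTransposeInvApp {F G : C ⥤ D} [G.Additive]
    (η : F ⟶ leftSatelliteFunctor G) (X : C) :
    rightSatelliteπ F X ≫ satelliteTransposeInvApp η X =
      toLeftSatelliteApp η (cosyzygy X) ≫ leftConnecting G X :=
  cokernel.π_desc _ _ _

/-- The transpose `S¹F ⟶ G` of `η : F ⟶ S₁G`. -/
def satelliteTransposeInv {F G : C ⥤ D} [F.Additive] [G.Additive]
    (η : F ⟶ leftSatelliteFunctor G) : rightSatelliteFunctor F ⟶ G where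
  app X := satelliteTransposeInvApp η X
  naturality X Y f := by
    change rightSatelliteMap F f ≫ satelliteTransposeInvApp η Y =
      satelliteTransposeInvApp η X ≫ G.map f
    rw [← cancel_epi (rightSatelliteπ F X), ← Category.assoc, rightSatelliteπ_map, Category.assoc,
      π_satelliteTransposeInvApp, ← Category.assoc (rightSatelliteπ F X),
      π_satelliteTransposeInvApp, Category.assoc, ← leftConnecting_naturality,
      ← Category.assoc, toLeftSatelliteApp_naturality, Category.assoc]

/-- `Hom(S¹F, G) ≃ Hom(F, S₁G)`. -/
def satelliteHomEquiv (F G : C ⥤ D) [F.Additive] [G.Additive] :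
    (rightSatelliteFunctor F ⟶ G) ≃ (F ⟶ leftSatelliteFunctor G) where
  toFun := satelliteTranspose
  invFun := satelliteTransposeInv
  left_inv θ := by
    ext X
    change satelliteTransposeInvApp (satelliteTranspose θ) X = ofRightSatelliteApp θ X
    rw [← cancel_epi (rightSatelliteπ F X), π_satelliteTransposeInvApp, leftConnecting,
      ← Category.assoc]
    change (satelliteTransposeApp θ _ ≫ _) ≫ _ = _
    rw [satelliteTransposeApp_ι, Category.assoc, ← ofRightSatelliteApp_naturality,
      ← Category.assoc]
    -- What remains is a triangle identity: `F(ΣX) ⟶ S¹F(ΩΣX) ⟶ S¹F(X)` is the projection. Both `ΣX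
    -- ⟶ ΣΩΣX ⟶ ΣX` and the identity complete `ΩΣX ⟶ X` to a map from the syzygy sequence of `ΣX` to
    -- the cosyzygy sequence of `X`.
    congr 1
    obtain ⟨e, he, hd⟩ := toCosyzygySyzygy_spec (cosyzygy X)
    obtain ⟨e', he', hc⟩ := ofSyzygyCosyzygy_spec X
    rw [rightConnecting, Category.assoc, rightSatelliteπ_map, ← F.map_comp_assoc]
    refine (map_comp_rightSatelliteπ_eq F (syzygy_shortExact (cosyzygy X)) (d' := 𝟙 _)
      (e := e ≫ underMap (ofSyzygyCosyzygy X)) (e' := e') ?_ ?_ ?_).trans (by simp)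
    · dsimp
      rw [reassoc_of% he, ι_underMap, hc]
    · dsimp
      rw [reassoc_of% hd, π_cosyzygyMap, Category.assoc]
    · simp [he']
  right_inv η := by
    ext X
    change satelliteTransposeApp (satelliteTransposeInv η) X = toLeftSatelliteApp η X
    rw [← cancel_mono (leftSatelliteι G X), satelliteTransposeApp_ι, rightConnecting,
      Category.assoc]
    change _ ≫ _ ≫ satelliteTransposeInvApp η _ = _
    rw [π_satelliteTransposeInvApp, ← Category.assoc, toLeftSatelliteApp_naturality,
      Category.assoc]
    congr 1
    obtain ⟨e, he, hd⟩ := toCosyzygySyzygy_spec X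
    obtain ⟨e', he', hc⟩ := ofSyzygyCosyzygy_spec (syzygy X)
    rw [leftConnecting, ← Category.assoc, leftSatelliteMap_ι, Category.assoc, ← G.map_comp]
    refine (leftSatelliteι_comp_map_eq G (cosyzygy_shortExact (syzygy X)) (c' := 𝟙 _)
      (e := overMap (toCosyzygySyzygy X) ≫ e') (e' := e) ?_ ?_ ?_).trans (by simp)
    · dsimp
      rw [Category.assoc, he', overMap_π, hd]
    · dsimp
      rw [Category.assoc, hc, ← Category.assoc, syzygyMap_ι, Category.assoc]
    · simp [he]

lemma satelliteTransposeInvApp_comp {F F' G : C ⥤ D} [F.Additive] [F'.Additive] [G.Additive]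
    (α : F ⟶ F') (η : F' ⟶ leftSatelliteFunctor G) (X : C) :
    satelliteTransposeInvApp (α ≫ η) X =
      rightSatelliteApp α X ≫ satelliteTransposeInvApp η X := by
  rw [← cancel_epi (rightSatelliteπ F X), π_satelliteTransposeInvApp,
    ← Category.assoc (rightSatelliteπ F X), rightSatelliteπ_app, Category.assoc,
    π_satelliteTransposeInvApp, ← Category.assoc]
  rfl

lemma satelliteTransposeApp_comp {F G G' : C ⥤ D} [F.Additive] [G.Additive] [G'.Additive]
    (θ : rightSatelliteFunctor F ⟶ G) (β : G ⟶ G') (X : C) :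
    satelliteTransposeApp (θ ≫ β) X = satelliteTransposeApp θ X ≫ leftSatelliteApp β X := by
  rw [← cancel_mono (leftSatelliteι G' X), satelliteTransposeApp_ι, Category.assoc,
    leftSatelliteApp_ι, ← Category.assoc _ (leftSatelliteι G X),
    satelliteTransposeApp_ι, Category.assoc]
  rfl

variable (C D)

/-- The right satellite `S¹` is left adjoint to the left satellite `S₁`. -/
def satelliteAdjunction : rightSatellite C D ⊣ leftSatellite C D :=
  Adjunction.mkOfHomEquiv
    { homEquiv F G :=
        { toFun θ := ObjectProperty.homMk (satelliteHomEquiv F.obj G.obj θ.hom)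
          invFun η := ObjectProperty.homMk ((satelliteHomEquiv F.obj G.obj).symm η.hom)
          left_inv θ := ObjectProperty.hom_ext _ ((satelliteHomEquiv F.obj G.obj).left_inv θ.hom)
          right_inv η := ObjectProperty.hom_ext _ ((satelliteHomEquiv F.obj G.obj).right_inv η.hom) }
      homEquiv_naturality_left_symm α η := by
        ext X
        exact satelliteTransposeInvApp_comp α.hom η.hom X
      homEquiv_naturality_right θ β := by
        ext X
        exact satelliteTransposeApp_comp θ.hom β.hom X }

/-- The two ways to iterate the left satellite agree. -/
def leftSatelliteIterComm :
    ∀ n : ℕ, leftSatellite C D ⋙ leftSatelliteIter C D n ≅ leftSatelliteIter C D (n + 1)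
  | 0 => Functor.rightUnitor _ ≪≫ (Functor.leftUnitor _).symm
  | n + 1 => Functor.isoWhiskerRight (leftSatelliteIterComm n) (leftSatellite C D)

/-- The iterated right satellite `Sⁿ` is left adjoint to the iterated left satellite `Sₙ`. -/
def satelliteIterAdjunction :
    ∀ n : ℕ, rightSatelliteIter C D n ⊣ leftSatelliteIter C D n
  | 0 => Adjunction.id
  -- Composing adjunctions reverses the order on the right: it yields `S₁` followed by `Sₙ`, whereas
  -- the iterate applies `Sₙ` first.
  | n + 1 => ((satelliteIterAdjunction n).comp (satelliteAdjunction C D)).ofNatIsoRight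
      (leftSatelliteIterComm C D n)

end Adjunction

/-! ### Finitely presented modules and coherence -/

section FinitelyPresented

variable {A : Type u} [Ring A]

lemma finitelyPresentedModules_of_exact {S : ShortComplex (ModuleCat.{u} A)} (hS : S.Exact)
    [Epi S.g] (h₁ : finitelyPresentedModules A S.X₁) (h₂ : finitelyPresentedModules A S.X₂) :
    finitelyPresentedModules A S.X₃ := by
  have : Module.FinitePresentation A S.X₁ := h₁
  have : Module.FinitePresentation A S.X₂ := h₂
  refine Module.finitePresentation_of_surjective S.g.hom
    ((ModuleCat.epi_iff_surjective _).1 inferInstance) ?_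
  rw [← hS.moduleCat_range_eq_ker]
  exact Submodule.fg_range _

lemma finitelyPresentedModules_biprod {X Y : ModuleCat.{u} A}
    (hX : finitelyPresentedModules A X) (hY : finitelyPresentedModules A Y) :
    finitelyPresentedModules A (X ⊞ Y) := by
  have : Module.FinitePresentation A X := hX
  have : Module.FinitePresentation A Y := hY
  exact Module.FinitePresentation.of_equiv (ModuleCat.biprodIsoProd X Y).symm.toLinearEquiv

lemma finitelyPresentedModules_cokernel {X Y : ModuleCat.{u} A} (f : X ⟶ Y)
    (hX : finitelyPresentedModules A X) (hY : finitelyPresentedModules A Y) :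
    finitelyPresentedModules A (cokernel f) :=
  finitelyPresentedModules_of_exact (S := ShortComplex.mk f (cokernel.π f) (cokernel.condition f))
    (ShortComplex.exact_of_g_is_cokernel _ (cokernelIsCokernel _)) hX hY

lemma finitelyPresentedModules_of_isPushout {X Y Z W : ModuleCat.{u} A} {f : X ⟶ Y} {g : X ⟶ Z}
    {i : Y ⟶ W} {j : Z ⟶ W} (h : IsPushout f g i j) (hX : finitelyPresentedModules A X)
    (hY : finitelyPresentedModules A Y) (hZ : finitelyPresentedModules A Z) :
    finitelyPresentedModules A W :=
  have := h.epi_shortComplex_g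
  finitelyPresentedModules_of_exact h.exact_shortComplex hX (finitelyPresentedModules_biprod hY hZ)

/-- If the category of finitely presented modules is abelian, kernels of maps between finitely
presented modules are finitely presented. -/
theorem finitePresentation_ker (hA : Nonempty (Abelian (finitelyPresentedModules A).FullSubcategory))
    {X Y : Type u} [AddCommGroup X] [AddCommGroup Y] [Module A X] [Module A Y]
    [hX : Module.FinitePresentation A X] [hY : Module.FinitePresentation A Y] (f : X →ₗ[A] Y) :
    Module.FinitePresentation A (LinearMap.ker f) := by
  obtain ⟨_⟩ := hA
  -- The abelian structure is arbitrary, so its zero morphisms must be shown to be the zero linear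
  -- maps.
  have hzero (P Q : (finitelyPresentedModules A).FullSubcategory) :
      (0 : P ⟶ Q).hom = 0 := by
    have h : (0 : P ⟶ Q) = (0 : P ⟶ P) ≫ ObjectProperty.homMk (0 : P.obj ⟶ Q.obj) :=
      zero_comp.symm
    rw [h, ObjectProperty.FullSubcategory.comp_hom]
    exact comp_zero
  let X' : (finitelyPresentedModules A).FullSubcategory := ⟨ModuleCat.of A X, hX⟩
  let Y' : (finitelyPresentedModules A).FullSubcategory := ⟨ModuleCat.of A Y, hY⟩
  let A' : (finitelyPresentedModules A).FullSubcategory :=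
    ⟨ModuleCat.of A A, (inferInstance : Module.FinitePresentation A A)⟩
  let f' : X' ⟶ Y' := ObjectProperty.homMk (ModuleCat.ofHom f)
  let k : (kernel f').obj →ₗ[A] X := (kernel.ι f').hom.hom
  have hk (x) : f (k x) = 0 := by
    have h := congrArg (fun g ↦ g.hom) (kernel.condition f')
    rw [hzero] at h
    exact congrArg (fun g ↦ g.hom x) h
  -- Elements are maps from the finitely presented module `A`, so the categorical kernel has the
  -- same elements as the module kernel.
  let pt (M : (finitelyPresentedModules A).FullSubcategory) (x : M.obj) : A' ⟶ M :=
    ObjectProperty.homMk (ModuleCat.ofHom (LinearMap.toSpanSingleton A M.obj x))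
  have hpt (M) (x : M.obj) : (pt M x).hom.hom 1 = x := one_smul A x
  have hinj : Function.Injective k := by
    intro x y hxy
    have h : pt _ x ≫ kernel.ι f' = pt _ y ≫ kernel.ι f' := by
      ext
      change k ((1 : A) • x) = k ((1 : A) • y)
      rw [one_smul, one_smul, hxy]
    rw [cancel_mono] at h
    rw [← hpt _ x, ← hpt _ y, h]
  have hrange : LinearMap.range k = LinearMap.ker f := by
    ext x
    constructor
    · rintro ⟨y, rfl⟩
      exact hk y
    · intro hx
      have h : pt X' x ≫ f' = 0 := by
        ext
        rw [hzero]
        change f ((1 : A) • x) = 0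
        rw [one_smul, hx]
      refine ⟨(kernel.lift f' _ h).hom.hom 1, ?_⟩
      have h' := congrArg (fun g ↦ g.hom.hom (1 : A)) (kernel.lift_ι f' _ h)
      exact h'.trans (hpt X' x)
  have : Module.FinitePresentation A (kernel f').obj := (kernel f').property
  rw [← hrange]
  exact Module.FinitePresentation.of_equiv (LinearEquiv.ofInjective k hinj)

lemma finitelyPresentedModules_of_shortExact
    (hA : Nonempty (Abelian (finitelyPresentedModules A).FullSubcategory))
    {S : ShortComplex (ModuleCat.{u} A)} (hS : S.ShortExact)
    (h₂ : finitelyPresentedModules A S.X₂) (h₃ : finitelyPresentedModules A S.X₃) :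
    finitelyPresentedModules A S.X₁ := by
  have : Module.FinitePresentation A S.X₂ := h₂
  have : Module.FinitePresentation A S.X₃ := h₃
  have := finitePresentation_ker hA S.g.hom
  rw [← hS.exact.moduleCat_range_eq_ker] at this
  have := hS.mono_f
  exact Module.FinitePresentation.of_equiv
    (LinearEquiv.ofInjective S.f.hom ((ModuleCat.mono_iff_injective _).1 inferInstance)).symm

/-- Over a coherent ring, a finitely presented module has a syzygy sequence of finitely presented
modules. -/
lemma exists_finitelyPresented_syzygy
    (hA : Nonempty (Abelian (finitelyPresentedModules A).FullSubcategory))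
    {X : ModuleCat.{u} A} (hX : finitelyPresentedModules A X) :
    ∃ (K P : ModuleCat.{u} A) (j : K ⟶ P) (q : P ⟶ X) (w : j ≫ q = 0),
      (ShortComplex.mk j q w).ShortExact ∧ Projective P ∧
        finitelyPresentedModules A K ∧ finitelyPresentedModules A P := by
  have : Module.FinitePresentation A X := hX
  obtain ⟨n, p, hp⟩ := Module.Finite.exists_fin' A X
  let q : ModuleCat.of A (Fin n → A) ⟶ X := ModuleCat.ofHom p
  have : Epi q := (ModuleCat.epi_iff_surjective _).2 hp
  have hS : (ShortComplex.mk (kernel.ι q) q (kernel.condition q)).ShortExact :=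
    { exact := ShortComplex.exact_of_f_is_kernel _ (kernelIsKernel _) }
  have hP : finitelyPresentedModules A (ModuleCat.of A (Fin n → A)) :=
    (inferInstance : Module.FinitePresentation A (Fin n → A))
  exact ⟨_, _, _, q, _, hS, (IsProjective.iff_projective _).1 inferInstance,
    finitelyPresentedModules_of_shortExact hA hS hP hX, hP⟩

end FinitelyPresented

/-! ### Left projective approximations from left coherence -/

section Approximation

/-- Over a left coherent ring `R`, a finitely presented right module has a map to a finite free
module through which all linear forms factor. -/
lemma exists_linearForm_approximation {R : Type u} [Ring R]
    (hR : Nonempty (Abelian (finitelyPresentedModules R).FullSubcategory))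
    (Y : Type u) [AddCommGroup Y] [Module Rᵐᵒᵖ Y] [Module.FinitePresentation Rᵐᵒᵖ Y] :
    ∃ (k : ℕ) (b : Y →ₗ[Rᵐᵒᵖ] (Fin k → Rᵐᵒᵖ)), ∀ φ : Y →ₗ[Rᵐᵒᵖ] Rᵐᵒᵖ,
      ∃ ψ : (Fin k → Rᵐᵒᵖ) →ₗ[Rᵐᵒᵖ] Rᵐᵒᵖ, ψ ∘ₗ b = φ := by
  obtain ⟨n, m, p, g, hp, hgp⟩ := Module.FinitePresentation.exists_fin' Rᵐᵒᵖ Y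
  -- `N` is the transpose of the presentation `g`. Linear forms on `Y` are rows `c` with `N c = 0`,
  -- so the dual of `Y` is the kernel of a map of finite free left modules, hence finitely generated
  -- by left coherence. The components of `b` are generators of this dual.
  let N : (Fin n → R) →ₗ[R] (Fin m → R) :=
    Matrix.vecMulLinear (Matrix.of fun j i ↦ (g (Pi.single i 1) j).unop)
  let form {l : ℕ} (c : Fin l → R) : (Fin l → Rᵐᵒᵖ) →ₗ[Rᵐᵒᵖ] Rᵐᵒᵖ :=
    Fintype.linearCombination Rᵐᵒᵖ fun j ↦ MulOpposite.op (c j)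
  have hform {l : ℕ} (c : Fin l → R) (v) : form c v = ∑ j, v j * MulOpposite.op (c j) := rfl
  have hN (c : Fin n → R) : N c = 0 ↔ form c ∘ₗ g = 0 := by
    have h (i : Fin m) : form c (g (Pi.single i 1)) = MulOpposite.op (N c i) := by
      rw [hform]
      simp [N, Matrix.vecMul, dotProduct, Finset.op_sum]
    constructor
    · intro hc
      refine LinearMap.pi_ext' fun i ↦ LinearMap.ext_ring ?_
      simpa [hc] using h i
    · intro hc
      ext i
      have := h i
      rw [← LinearMap.comp_apply, hc] at this
      simpa using this.symm
  have hdesc (c : Fin n → R) (hc : N c = 0) : ∃ φ : Y →ₗ[Rᵐᵒᵖ] Rᵐᵒᵖ, φ ∘ₗ p = form c := by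
    have hle : LinearMap.ker p ≤ LinearMap.ker (form c) := by
      intro v hv
      obtain ⟨w, rfl⟩ := (hgp v).1 hv
      exact LinearMap.congr_fun ((hN c).1 hc) w
    refine ⟨(LinearMap.ker p).liftQ (form c) hle ∘ₗ
      (p.quotKerEquivOfSurjective hp).symm.toLinearMap, ?_⟩
    refine LinearMap.ext fun v ↦ ?_
    have : (p.quotKerEquivOfSurjective hp).symm (p v) = (LinearMap.ker p).mkQ v := by
      rw [LinearEquiv.symm_apply_eq]
      rfl
    simp [this]
  have hfp := finitePresentation_ker hR N
  obtain ⟨k, s, hs⟩ := Submodule.fg_iff_exists_fin_generating_family.1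
    (Module.Finite.iff_fg.1 (inferInstance : Module.Finite R (LinearMap.ker N)))
  have hsN (l : Fin k) : N (s l) = 0 :=
    (hs ▸ Submodule.subset_span ⟨l, rfl⟩ : s l ∈ LinearMap.ker N)
  choose b hb using fun l ↦ hdesc (s l) (hsN l)
  refine ⟨k, LinearMap.pi b, fun φ ↦ ?_⟩
  let c : Fin n → R := fun j ↦ (φ (p (Pi.single j 1))).unop
  have hc : form c = φ ∘ₗ p := by
    refine LinearMap.pi_ext' fun j ↦ LinearMap.ext_ring ?_
    simp [form, c, Fintype.linearCombination_apply_single]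
  have hcN : c ∈ LinearMap.ker N := by
    rw [LinearMap.mem_ker, hN, hc, LinearMap.comp_assoc, hgp.linearMap_comp_eq_zero,
      LinearMap.comp_zero]
  rw [← hs, Submodule.mem_span_range_iff_exists_fun] at hcN
  obtain ⟨a, ha⟩ := hcN
  refine ⟨form a, ?_⟩
  rw [← LinearMap.cancel_right hp, ← hc]
  refine LinearMap.ext fun v ↦ ?_
  have hb' (l) : b l (p v) = form (s l) v := LinearMap.congr_fun (hb l) v
  simp only [LinearMap.comp_apply, hform, LinearMap.pi_apply, hb', Finset.sum_mul, mul_assoc,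
    ← MulOpposite.op_mul, ← ha, Finset.sum_apply, Pi.smul_apply, smul_eq_mul, Finset.op_sum,
    Finset.mul_sum]
  exact Finset.sum_comm

/-- A map `b : Y ⟶ Q` is a left projective approximation if `Q` is projective and every map from
`Y` to a projective object factors through `b`. -/
structure IsProjectiveApproximation {C : Type*} [Category C] {Y Q : C} (b : Y ⟶ Q) : Prop where
  projective : Projective Q
  exists_factor {P : C} (hP : Projective P) (g : Y ⟶ P) : ∃ h : Q ⟶ P, b ≫ h = g

/-- Over a left coherent ring, finitely presented right modules have finitely presented left
projective approximations. -/
theorem exists_isProjectiveApproximation {R : Type u} [Ring R]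
    (hR : Nonempty (Abelian (finitelyPresentedModules R).FullSubcategory))
    {Y : ModuleCat.{u} Rᵐᵒᵖ} (hY : finitelyPresentedModules Rᵐᵒᵖ Y) :
    ∃ (Q : ModuleCat.{u} Rᵐᵒᵖ) (b : Y ⟶ Q), finitelyPresentedModules Rᵐᵒᵖ Q ∧
      IsProjectiveApproximation b := by
  have : Module.FinitePresentation Rᵐᵒᵖ Y := hY
  obtain ⟨k, b, hb⟩ := exists_linearForm_approximation hR Y
  refine ⟨ModuleCat.of _ (Fin k → Rᵐᵒᵖ), ModuleCat.ofHom b,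
    (inferInstance : Module.FinitePresentation Rᵐᵒᵖ (Fin k → Rᵐᵒᵖ)),
    (IsProjective.iff_projective _).1 inferInstance, fun {P} hP g ↦ ?_⟩
  have : Module.Projective Rᵐᵒᵖ P := (IsProjective.iff_projective _).2 hP
  -- Embedding `P` as a summand of a free module reduces to maps into a free module. Since `Y` is
  -- finitely generated only finitely many coordinates matter, and each is a linear form.
  obtain ⟨s, hs⟩ := Module.projective_def'.1 this
  let φ : Y →ₗ[Rᵐᵒᵖ] (P →₀ Rᵐᵒᵖ) := s ∘ₗ g.hom
  classical
  obtain ⟨G, hG⟩ := (Module.Finite.fg_top : (⊤ : Submodule Rᵐᵒᵖ Y).FG)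
  let S : Finset P := G.biUnion fun y ↦ (φ y).support
  have hS (y : Y) : φ y ∈ Finsupp.supported Rᵐᵒᵖ Rᵐᵒᵖ (S : Set P) := by
    have h : (⊤ : Submodule Rᵐᵒᵖ Y) ≤ (Finsupp.supported Rᵐᵒᵖ Rᵐᵒᵖ (S : Set P)).comap φ := by
      rw [← hG, Submodule.span_le]
      intro y hy
      exact Finset.coe_subset.2 (Finset.subset_biUnion_of_mem (fun y ↦ (φ y).support) hy)
    exact h trivial
  choose ψ hψ using fun i : P ↦ hb (Finsupp.lapply i ∘ₗ φ)
  let h : (Fin k → Rᵐᵒᵖ) →ₗ[Rᵐᵒᵖ] (P →₀ Rᵐᵒᵖ) := ∑ i ∈ S, Finsupp.lsingle i ∘ₗ ψ i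
  have hh : h ∘ₗ b = φ := by
    ext y : 1
    have hψ' (i) : ψ i (b y) = φ y i := LinearMap.congr_fun (hψ i) y
    simp only [h, LinearMap.comp_apply, LinearMap.sum_apply, hψ', Finsupp.lsingle_apply]
    have := Finsupp.sum_of_support_subset (φ y) (Finset.coe_subset.1 (hS y)) Finsupp.single (by simp)
    rw [← this, Finsupp.sum_single]
  refine ⟨ModuleCat.ofHom (Finsupp.linearCombination Rᵐᵒᵖ id ∘ₗ h), ?_⟩
  ext y
  have h₁ : h (b y) = s (g.hom y) := LinearMap.congr_fun hh y
  have h₂ := LinearMap.congr_fun hs (g.hom y)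
  change Finsupp.linearCombination Rᵐᵒᵖ id (h (b y)) = g.hom y
  rw [h₁]
  exact h₂

end Approximation

/-! ### Presentations by elements -/

section Presentation

variable {A : Type u} [Ring A]

/-- The element `x ∈ F(X)` and the map `f : X ⟶ Y` present `F` as the cokernel of
`(f, -) : (Y, -) ⟶ (X, -)`. -/
structure IsPresentation (F : ModuleCat.{u} A ⥤ AddCommGrpCat.{u}) {X Y : ModuleCat.{u} A}
    (f : X ⟶ Y) (x : F.obj X) : Prop where
  exists_map_eq {M : ModuleCat.{u} A} (m : F.obj M) : ∃ g : X ⟶ M, F.map g x = m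
  map_eq_zero_iff {M : ModuleCat.{u} A} (g : X ⟶ M) : F.map g x = 0 ↔ ∃ h : Y ⟶ M, f ≫ h = g

lemma IsPresentation.map_comp_eq_zero {F : ModuleCat.{u} A ⥤ AddCommGrpCat.{u}}
    {X Y : ModuleCat.{u} A} {f : X ⟶ Y} {x : F.obj X} (h : IsPresentation F f x)
    {M : ModuleCat.{u} A} (g : Y ⟶ M) : F.map (f ≫ g) x = 0 :=
  (h.map_eq_zero_iff _).2 ⟨g, rfl⟩

lemma map_apply_eq_of_naturality {F : ModuleCat.{u} A ⥤ AddCommGrpCat.{u}} {X M : ModuleCat.{u} A}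
    (π : preadditiveCoyoneda.obj (op X) ⟶ F) (g : X ⟶ M) :
    F.map g (π.app X (𝟙 X)) = π.app M g := by
  have h := ConcreteCategory.congr_hom (π.naturality g) (𝟙 X)
  exact h.symm.trans (congrArg (π.app M) (Category.id_comp g))

/-- The natural transformation `(X, -) ⟶ F` given by an element of `F(X)`. -/
def ofElement (F : ModuleCat.{u} A ⥤ AddCommGrpCat.{u}) [F.Additive] {X : ModuleCat.{u} A}
    (x : F.obj X) : preadditiveCoyoneda.obj (op X) ⟶ F where
  app M := AddCommGrpCat.ofHom
    { toFun := fun g : X ⟶ M ↦ F.map g x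
      map_zero' := ConcreteCategory.congr_hom (F.map_zero X M) x
      map_add' := fun g h : X ⟶ M ↦ ConcreteCategory.congr_hom (F.map_add (f := g) (g := h)) x }
  naturality M N k := by
    ext g
    exact ConcreteCategory.congr_hom (F.map_comp g k) x

/-- Yoneda: `α` and `π` are determined by the images `f` and `x` of the identities. -/
lemma tfp_iff (F : ModuleCat.{u} A ⥤+ AddCommGrpCat.{u}) :
    tfp A F ↔ ∃ (X Y : ModuleCat.{u} A) (f : X ⟶ Y) (x : F.obj.obj X),
      finitelyPresentedModules A X ∧ finitelyPresentedModules A Y ∧ IsPresentation F.obj f x := by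
  constructor
  · rintro ⟨X, Y, hX, hY, α, π, h⟩
    refine ⟨X, Y, α.app Y (𝟙 Y), π.app X (𝟙 X), hX, hY, fun {M} m ↦ ?_, fun {M} g ↦ ?_⟩
    · obtain ⟨g, rfl⟩ := (h M).2 m
      exact ⟨g, map_apply_eq_of_naturality π g⟩
    · rw [map_apply_eq_of_naturality]
      refine ((h M).1 g).trans ⟨?_, ?_⟩
      · rintro ⟨k, rfl⟩
        exact ⟨k, map_apply_eq_of_naturality α k⟩
      · rintro ⟨k, rfl⟩
        exact ⟨k, (map_apply_eq_of_naturality α k).symm⟩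
  · rintro ⟨X, Y, f, x, hX, hY, h⟩
    exact ⟨X, Y, hX, hY, preadditiveCoyoneda.map f.op, ofElement F.obj x,
      fun M ↦ ⟨fun g ↦ h.map_eq_zero_iff g, fun m ↦ h.exists_map_eq m⟩⟩

end Presentation

/-! ### Presentation of the right satellite -/

section Right

variable {A : Type u} [Ring A] {F : ModuleCat.{u} A ⥤ AddCommGrpCat.{u}} [F.Additive]

lemma rightSatelliteπ_surjective (F : ModuleCat.{u} A ⥤ AddCommGrpCat.{u}) (M : ModuleCat.{u} A) :
    Function.Surjective (rightSatelliteπ F M) :=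
  (AddCommGrpCat.epi_iff_surjective _).1 inferInstance

lemma rightSatelliteπ_eq_zero_iff (F : ModuleCat.{u} A ⥤ AddCommGrpCat.{u}) {M : ModuleCat.{u} A}
    (y : F.obj (cosyzygy M)) :
    rightSatelliteπ F M y = 0 ↔ ∃ z, F.map (cosyzygyπ M) z = y := by
  have h : (ShortComplex.mk _ _ (map_rightSatelliteπ F M)).Exact :=
    ShortComplex.exact_of_g_is_cokernel _ (cokernelIsCokernel _)
  rw [ShortComplex.ab_exact_iff] at h
  refine ⟨h y, ?_⟩
  rintro ⟨z, rfl⟩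
  exact ConcreteCategory.congr_hom (map_rightSatelliteπ F M) z

/-- For a short exact sequence `S` and `x ∈ F(S.X₃)`, the map `g : S.X₁ ⟶ M` represents
`m ∈ S¹F(M)` if `m` is the class of `F(d)(x)`, for a map `(g, e, d)` from `S` to the cosyzygy
sequence of `M`. -/
def RepresentsRight (S : ShortComplex (ModuleCat.{u} A)) (x : F.obj S.X₃)
    {M : ModuleCat.{u} A} (g : S.X₁ ⟶ M) (m : (rightSatelliteFunctor F).obj M) : Prop :=
  ∃ (e : S.X₂ ⟶ Injective.under M) (d : S.X₃ ⟶ cosyzygy M),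
    S.f ≫ e = g ≫ Injective.ι M ∧ S.g ≫ d = e ≫ cosyzygyπ M ∧
      rightSatelliteπ F M (F.map d x) = m

variable {S : ShortComplex (ModuleCat.{u} A)} {x : F.obj S.X₃} {M N : ModuleCat.{u} A}
  {g : S.X₁ ⟶ M} {m m' : (rightSatelliteFunctor F).obj M}

lemma RepresentsRight.unique (hS : S.ShortExact) (h : RepresentsRight S x g m)
    (h' : RepresentsRight S x g m') : m = m' := by
  obtain ⟨e, d, he, hd, rfl⟩ := h
  obtain ⟨e', d', he', hd', rfl⟩ := h'
  exact ConcreteCategory.congr_hom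
    (map_comp_rightSatelliteπ_eq F hS (he.trans he'.symm) hd hd') x

lemma RepresentsRight.comp (h : RepresentsRight S x g m) (k : M ⟶ N) :
    RepresentsRight S x (g ≫ k) ((rightSatelliteFunctor F).map k m) := by
  obtain ⟨e, d, he, hd, rfl⟩ := h
  refine ⟨e ≫ underMap k, d ≫ cosyzygyMap k, ?_, ?_, ?_⟩
  · rw [reassoc_of% he, ι_underMap, Category.assoc]
  · rw [reassoc_of% hd, π_cosyzygyMap, Category.assoc]
  · rw [F.map_comp]
    exact (ConcreteCategory.congr_hom (rightSatelliteπ_map F k) (F.map d x)).symm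

lemma exists_representsRight (hS : S.ShortExact) (x : F.obj S.X₃) (g : S.X₁ ⟶ M) :
    ∃ m, RepresentsRight S x g m := by
  obtain ⟨e, d, he, hd⟩ := exists_map_cosyzygy hS g
  exact ⟨_, e, d, he, hd, rfl⟩

lemma IsPresentation.exists_representsRight {Y : ModuleCat.{u} A} {f : S.X₃ ⟶ Y}
    (hF : IsPresentation F f x) (hP : Projective S.X₂) (m : (rightSatelliteFunctor F).obj M) :
    ∃ g : S.X₁ ⟶ M, RepresentsRight S x g m := by
  obtain ⟨y, rfl⟩ := rightSatelliteπ_surjective F M m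
  obtain ⟨d, rfl⟩ := hF.exists_map_eq y
  have he := Projective.factorThru_comp (S.g ≫ d) (cosyzygyπ M)
  have hw : (S.f ≫ Projective.factorThru (S.g ≫ d) (cosyzygyπ M)) ≫ cosyzygyπ M = 0 := by
    rw [Category.assoc, he, S.zero_assoc, zero_comp]
  exact ⟨(cosyzygy_shortExact M).exact.lift _ hw, _, d,
    ((cosyzygy_shortExact M).exact.lift_f _ hw).symm, he.symm, rfl⟩

/-- The class of `F(d)(x)` vanishes exactly when `d` is a map lifting to `I` plus a map factoring
through `φ.τ₃`. Restricted to `S.X₁`, the first kind contributes maps extending over `S.X₂`, the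
second maps factoring through `φ.τ₁`. -/
lemma RepresentsRight.eq_zero_iff {T : ShortComplex (ModuleCat.{u} A)} (hS : S.ShortExact)
    (hT : T.ShortExact) (hT₂ : Projective T.X₂) (φ : S ⟶ T) (hF : IsPresentation F φ.τ₃ x)
    (h : RepresentsRight S x g m) :
    m = 0 ↔ ∃ (s : S.X₂ ⟶ M) (t : T.X₁ ⟶ M), S.f ≫ s + φ.τ₁ ≫ t = g := by
  have := hS.epi_g
  obtain ⟨e, d, he, hd, rfl⟩ := h
  refine (rightSatelliteπ_eq_zero_iff F _).trans ⟨?_, ?_⟩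
  · rintro ⟨z, hz⟩
    obtain ⟨e', rfl⟩ := hF.exists_map_eq z
    have h0 : F.map (d - e' ≫ cosyzygyπ M) x = 0 := by
      rw [F.map_sub, F.map_comp]
      exact sub_eq_zero.2 hz.symm
    obtain ⟨d', hd'⟩ := (hF.map_eq_zero_iff _).1 h0
    -- Lifting `d'` over `T.X₂` yields `t` on `T.X₁`; what is left of `e` is killed by `I ⟶ ΣM` and
    -- so yields `s`.
    have he'' := Projective.factorThru_comp (T.g ≫ d') (cosyzygyπ M)
    set e'' := Projective.factorThru (T.g ≫ d') (cosyzygyπ M)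
    have ht : (T.f ≫ e'') ≫ cosyzygyπ M = 0 := by
      rw [Category.assoc, he'', T.zero_assoc, zero_comp]
    have hs : (e - φ.τ₂ ≫ e'' - S.g ≫ e') ≫ cosyzygyπ M = 0 := by
      rw [Preadditive.sub_comp, Preadditive.sub_comp, Category.assoc, Category.assoc, he'',
        φ.comm₂₃_assoc, hd', ← hd, Preadditive.comp_sub]
      abel
    refine ⟨(cosyzygy_shortExact M).exact.lift _ hs, (cosyzygy_shortExact M).exact.lift _ ht, ?_⟩
    rw [← cancel_mono (Injective.ι M), Preadditive.add_comp, Category.assoc, Category.assoc]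
    have h₁ := (cosyzygy_shortExact M).exact.lift_f _ hs
    have h₂ := (cosyzygy_shortExact M).exact.lift_f _ ht
    dsimp only at h₁ h₂
    rw [h₁, h₂, Preadditive.comp_sub, Preadditive.comp_sub, S.zero_assoc, zero_comp, sub_zero,
      ← φ.comm₁₂_assoc, he, sub_add_cancel]
  · rintro ⟨s, t, hst⟩
    obtain ⟨e'', d', he'', hd'⟩ := exists_map_cosyzygy hT t
    have h0 : S.f ≫ (e - s ≫ Injective.ι M - φ.τ₂ ≫ e'') = 0 := by
      rw [Preadditive.comp_sub, Preadditive.comp_sub, he, ← hst, Preadditive.add_comp,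
        ← φ.comm₁₂_assoc, he'', Category.assoc, Category.assoc]
      abel
    have hd : d = φ.τ₃ ≫ d' + hS.exact.desc _ h0 ≫ cosyzygyπ M := by
      rw [← cancel_epi S.g, Preadditive.comp_add, hS.exact.g_desc_assoc, hd, ← φ.comm₂₃_assoc, hd',
        Preadditive.sub_comp, Preadditive.sub_comp, Category.assoc, Category.assoc,
        cokernel.condition, comp_zero]
      abel
    refine ⟨F.map (hS.exact.desc _ h0) x, ?_⟩
    rw [hd, F.map_add, F.map_comp _ (cosyzygyπ M)]
    refine Eq.trans ?_ (congrArg (· + _) (hF.map_comp_eq_zero d').symm)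
    exact (zero_add _).symm

/-- The presentation of `S¹F` obtained from one of `F`. -/
lemma IsPresentation.rightSatellite {T : ShortComplex (ModuleCat.{u} A)} (hS : S.ShortExact)
    (hT : T.ShortExact) (hS₂ : Projective S.X₂) (hT₂ : Projective T.X₂) (φ : S ⟶ T)
    (hF : IsPresentation F φ.τ₃ x) :
    ∃ y, IsPresentation (rightSatelliteFunctor F) (biprod.lift S.f φ.τ₁) y := by
  -- The universal element is the one represented by the identity.
  obtain ⟨y, hy⟩ := Satellites.exists_representsRight hS x (𝟙 S.X₁)
  have hcomp {M : ModuleCat.{u} A} (g : S.X₁ ⟶ M) :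
      RepresentsRight S x g ((rightSatelliteFunctor F).map g y) := by
    simpa using hy.comp g
  refine ⟨y, fun {M} m ↦ ?_, fun {M} g ↦ ?_⟩
  · obtain ⟨g, hg⟩ := hF.exists_representsRight hS₂ m
    exact ⟨g, (hcomp g).unique hS hg⟩
  · rw [(hcomp g).eq_zero_iff hS hT hT₂ φ hF]
    constructor
    · rintro ⟨s, t, h⟩
      exact ⟨biprod.desc s t, by rw [biprod.lift_desc, h]⟩
    · rintro ⟨h, rfl⟩
      exact ⟨biprod.inl ≫ h, biprod.inr ≫ h, by
        rw [← Category.assoc, ← Category.assoc, ← Preadditive.add_comp, biprod.lift_eq]⟩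

end Right

/-! ### Presentation of the left satellite -/

section Left

variable {A : Type u} [Ring A] {F : ModuleCat.{u} A ⥤ AddCommGrpCat.{u}} [F.Additive]

lemma leftSatelliteι_injective (F : ModuleCat.{u} A ⥤ AddCommGrpCat.{u}) (M : ModuleCat.{u} A) :
    Function.Injective (leftSatelliteι F M) :=
  (AddCommGrpCat.mono_iff_injective _).1 inferInstance

lemma exists_leftSatelliteι_eq_iff (F : ModuleCat.{u} A ⥤ AddCommGrpCat.{u}) {M : ModuleCat.{u} A}
    (y : F.obj (syzygy M)) :
    (∃ m, leftSatelliteι F M m = y) ↔ F.map (syzygyι M) y = 0 := by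
  have h : (ShortComplex.mk _ _ (leftSatelliteι_map F M)).Exact :=
    ShortComplex.exact_of_f_is_kernel _ (kernelIsKernel _)
  rw [ShortComplex.ab_exact_iff] at h
  refine ⟨?_, h y⟩
  rintro ⟨z, rfl⟩
  exact ConcreteCategory.congr_hom (leftSatelliteι_map F M) z

/-- For a right exact sequence `S` and `x ∈ F(S.X₁)`, the map `u : S.X₃ ⟶ M` represents
`m ∈ S₁F(M)` if the image of `m` in `F(ΩM)` is `F(g)(x)`, for a map `(g, h, u)` from `S` to the
syzygy sequence of `M`. -/
def RepresentsLeft (S : ShortComplex (ModuleCat.{u} A)) (x : F.obj S.X₁)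
    {M : ModuleCat.{u} A} (u : S.X₃ ⟶ M) (m : (leftSatelliteFunctor F).obj M) : Prop :=
  ∃ (h : S.X₂ ⟶ Projective.over M) (g : S.X₁ ⟶ syzygy M),
    h ≫ Projective.π M = S.g ≫ u ∧ g ≫ syzygyι M = S.f ≫ h ∧ leftSatelliteι F M m = F.map g x

variable {S : ShortComplex (ModuleCat.{u} A)} {x : F.obj S.X₁} {M N : ModuleCat.{u} A}
  {u : S.X₃ ⟶ M} {m m' : (leftSatelliteFunctor F).obj M}

lemma RepresentsLeft.comp (h : RepresentsLeft S x u m) (k : M ⟶ N) :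
    RepresentsLeft S x (u ≫ k) ((leftSatelliteFunctor F).map k m) := by
  obtain ⟨h, g, hh, hg, hm⟩ := h
  refine ⟨h ≫ overMap k, g ≫ syzygyMap k, ?_, ?_, ?_⟩
  · rw [Category.assoc, overMap_π, reassoc_of% hh]
  · rw [Category.assoc, syzygyMap_ι, reassoc_of% hg]
  · refine (ConcreteCategory.congr_hom (leftSatelliteMap_ι F k) m).trans ?_
    rw [F.map_comp]
    exact congrArg (F.map (syzygyMap k)) hm

/-- A homotopy argument: `m` vanishes when `g` extends along `S.f` to some `g'`; then `h` minus `g'`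
descends to a lift of `u`. Conversely, a lift of `u` corrects `h` to a map into `ΩM`. -/
lemma RepresentsLeft.eq_zero_iff (hS : S.Exact) (hg : Epi S.g) (hF : IsPresentation F S.f x)
    (h : RepresentsLeft S x u m) :
    m = 0 ↔ ∃ w : S.X₃ ⟶ Projective.over M, w ≫ Projective.π M = u := by
  obtain ⟨h, g, hh, hg, hm⟩ := h
  have hm0 : m = 0 ↔ ∃ g' : S.X₂ ⟶ syzygy M, S.f ≫ g' = g := by
    rw [← hF.map_eq_zero_iff, ← hm]
    exact (map_eq_zero_iff (leftSatelliteι F M).hom (leftSatelliteι_injective F M)).symm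
  rw [hm0]
  constructor
  · rintro ⟨g', rfl⟩
    have h0 : S.f ≫ (h - g' ≫ syzygyι M) = 0 := by
      rw [Preadditive.comp_sub, ← hg, Category.assoc, sub_self]
    refine ⟨hS.desc _ h0, ?_⟩
    rw [← cancel_epi S.g, hS.g_desc_assoc, Preadditive.sub_comp, hh, Category.assoc,
      kernel.condition, comp_zero, sub_zero]
  · rintro ⟨w, rfl⟩
    have h0 : (h - S.g ≫ w) ≫ Projective.π M = 0 := by
      rw [Preadditive.sub_comp, hh, Category.assoc, sub_self]
    refine ⟨kernel.lift _ _ h0, ?_⟩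
    rw [← cancel_mono (syzygyι M), Category.assoc, kernel.lift_ι, hg, Preadditive.comp_sub,
      S.zero_assoc, zero_comp, sub_zero]

lemma RepresentsLeft.unique (hS : S.Exact) (hg : Epi S.g) (hF : IsPresentation F S.f x)
    (h : RepresentsLeft S x u m) (h' : RepresentsLeft S x u m') : m = m' := by
  -- The difference is represented by the zero map, which lifts to the projective.
  have hsub : RepresentsLeft S x (u - u) (m - m') := by
    obtain ⟨h, g, hh, hg, hm⟩ := h
    obtain ⟨h', g', hh', hg', hm'⟩ := h'
    refine ⟨h - h', g - g', ?_, ?_, ?_⟩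
    · rw [Preadditive.sub_comp, Preadditive.comp_sub, hh, hh']
    · rw [Preadditive.sub_comp, Preadditive.comp_sub, hg, hg']
    · rw [F.map_sub]
      exact (map_sub (leftSatelliteι F M).hom m m').trans (congrArg₂ (· - ·) hm hm')
  exact sub_eq_zero.1 ((hsub.eq_zero_iff hS hg hF).2 ⟨0, by simp⟩)

/-- Only those `u` whose composite with `S.g` lifts to the projective over `M` represent an element;
the pushout `W` below is built to classify them. -/
lemma IsPresentation.exists_representsLeft_of_factor (hF : IsPresentation F S.f x)
    {u : S.X₃ ⟶ M} {h : S.X₂ ⟶ Projective.over M} (hh : h ≫ Projective.π M = S.g ≫ u) :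
    ∃ m, RepresentsLeft S x u m := by
  have h0 : (S.f ≫ h) ≫ Projective.π M = 0 := by
    rw [Category.assoc, hh, S.zero_assoc, zero_comp]
  have hg : kernel.lift _ _ h0 ≫ syzygyι M = S.f ≫ h := kernel.lift_ι _ _ h0
  obtain ⟨m, hm⟩ := (exists_leftSatelliteι_eq_iff F (F.map (kernel.lift _ _ h0) x)).2 (by
    rw [← ConcreteCategory.comp_apply, ← F.map_comp, hg]
    exact hF.map_comp_eq_zero h)
  exact ⟨m, h, _, hh, hg, hm⟩

lemma IsPresentation.exists_representsLeft (hS : S.Exact) (hg : Epi S.g)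
    (hF : IsPresentation F S.f x) (m : (leftSatelliteFunctor F).obj M) :
    ∃ u : S.X₃ ⟶ M, RepresentsLeft S x u m := by
  obtain ⟨g, hg⟩ := hF.exists_map_eq (leftSatelliteι F M m)
  have h0 : F.map (g ≫ syzygyι M) x = 0 := by
    rw [F.map_comp, ConcreteCategory.comp_apply, hg]
    exact (exists_leftSatelliteι_eq_iff F _).1 ⟨m, rfl⟩
  obtain ⟨h, hh⟩ := (hF.map_eq_zero_iff _).1 h0
  have hw : S.f ≫ h ≫ Projective.π M = 0 := by
    rw [reassoc_of% hh, kernel.condition, comp_zero]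
  exact ⟨hS.desc _ hw, h, g, (hS.g_desc _ hw).symm, hh.symm, hg.symm⟩

/-- The presentation of `S₁F` obtained from one of `F` and left projective approximations. -/
lemma IsPresentation.leftSatellite (hS : S.Exact) (hg : Epi S.g) (hF : IsPresentation F S.f x)
    {Q Q' W W' : ModuleCat.{u} A} {b : S.X₂ ⟶ Q} {a : S.X₃ ⟶ Q'}
    (hb : IsProjectiveApproximation b) (ha : IsProjectiveApproximation a)
    {w : S.X₃ ⟶ W} {β : Q ⟶ W} (hW : IsPushout S.g b w β)
    {σ : W ⟶ W'} {α : Q' ⟶ W'} (hW' : IsPushout w a σ α) :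
    ∃ y, IsPresentation (leftSatelliteFunctor F) σ y := by
  have := hb.projective
  have := ha.projective
  -- The universal element is represented by `w`: its composite with `S.g` factors through the
  -- projective `Q`.
  obtain ⟨y, hy⟩ := hF.exists_representsLeft_of_factor (u := w)
    (h := b ≫ Projective.factorThru β (Projective.π W))
    (by rw [Category.assoc, Projective.factorThru_comp, hW.w])
  refine ⟨y, fun {M} m ↦ ?_, fun {M} k ↦ ?_⟩
  · obtain ⟨u, hu⟩ := hF.exists_representsLeft hS hg m
    obtain ⟨h, _, hh, _⟩ := id hu
    obtain ⟨h', rfl⟩ := hb.exists_factor inferInstance h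
    have hw : S.g ≫ u = b ≫ h' ≫ Projective.π M := by rw [← hh, Category.assoc]
    refine ⟨hW.desc _ _ hw, (hy.comp (hW.desc _ _ hw)).unique hS hg hF ?_⟩
    rwa [hW.inl_desc]
  · rw [(hy.comp k).eq_zero_iff hS hg hF]
    constructor
    · rintro ⟨v, hv⟩
      -- A lift of `w ≫ k` to a projective factors through `a`, which is what is needed to extend
      -- `k` over the second pushout.
      obtain ⟨v', rfl⟩ := ha.exists_factor inferInstance v
      rw [Category.assoc] at hv
      exact ⟨hW'.desc _ _ hv.symm, hW'.inl_desc _ _ _⟩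
    · rintro ⟨r, rfl⟩
      refine ⟨a ≫ Projective.factorThru (α ≫ r) (Projective.π M), ?_⟩
      rw [Category.assoc, Projective.factorThru_comp, hW'.w_assoc]

end Left

/-! ### Preservation of totally finitely presented functors -/

section Main

theorem tfp_rightSatellite {A : Type u} [Ring A]
    (hA : Nonempty (Abelian (finitelyPresentedModules A).FullSubcategory))
    {F : ModuleCat.{u} A ⥤+ AddCommGrpCat.{u}} (hF : tfp A F) :
    tfp A ((rightSatellite _ _).obj F) := by
  obtain ⟨X, Y, f, x, hX, hY, h⟩ := (tfp_iff F).1 hF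
  obtain ⟨K, P, j, q, w, hS, hP, hK, hPfp⟩ := exists_finitelyPresented_syzygy hA hX
  obtain ⟨K', P', j', q', w', hT, hP', hK', hPfp'⟩ := exists_finitelyPresented_syzygy hA hY
  have := hT.epi_g
  have := hT.mono_f
  have hφ : Projective.factorThru (q ≫ f) q' ≫ q' = q ≫ f := Projective.factorThru_comp _ _
  have hw : (j ≫ Projective.factorThru (q ≫ f) q') ≫ q' = 0 := by
    rw [Category.assoc, hφ, reassoc_of% w, zero_comp]
  let φ : ShortComplex.mk j q w ⟶ ShortComplex.mk j' q' w' :=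
    { τ₁ := hT.exact.lift _ hw
      τ₂ := Projective.factorThru (q ≫ f) q'
      τ₃ := f
      comm₁₂ := hT.exact.lift_f _ hw
      comm₂₃ := hφ }
  obtain ⟨y, hy⟩ := IsPresentation.rightSatellite (x := x) hS hT hP hP' φ h
  exact (tfp_iff _).2 ⟨_, _, _, y, hK, finitelyPresentedModules_biprod hPfp hK', hy⟩

theorem tfp_leftSatellite {R : Type u} [Ring R]
    (hR : Nonempty (Abelian (finitelyPresentedModules R).FullSubcategory))
    {F : ModuleCat.{u} Rᵐᵒᵖ ⥤+ AddCommGrpCat.{u}} (hF : tfp Rᵐᵒᵖ F) :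
    tfp Rᵐᵒᵖ ((leftSatellite _ _).obj F) := by
  obtain ⟨X, Y, f, x, hX, hY, h⟩ := (tfp_iff F).1 hF
  have hZ := finitelyPresentedModules_cokernel f hX hY
  obtain ⟨Q, b, hQ, hb⟩ := exists_isProjectiveApproximation hR hY
  obtain ⟨Q', a, hQ', ha⟩ := exists_isProjectiveApproximation hR hZ
  have hW := IsPushout.of_hasPushout (cokernel.π f) b
  have hW' := IsPushout.of_hasPushout (pushout.inl (cokernel.π f) b) a
  have hWfp := finitelyPresentedModules_of_isPushout hW hY hZ hQ
  obtain ⟨y, hy⟩ := IsPresentation.leftSatellite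
    (S := ShortComplex.mk f (cokernel.π f) (cokernel.condition f)) (x := x)
    (ShortComplex.exact_of_g_is_cokernel _ (cokernelIsCokernel _)) inferInstance h hb ha hW hW'
  exact (tfp_iff _).2
    ⟨_, _, _, y, hWfp, finitelyPresentedModules_of_isPushout hW' hZ hWfp hQ', hy⟩

end Main

end Satellites

end

theorem mainTheorem3 (R : Type u) [Ring R] (hR : Satellites.IsCoherentRing R) :
    ∃ (hright : ∀ (n : ℕ) (F : ModuleCat.{u} Rᵐᵒᵖ ⥤+ AddCommGrpCat.{u}),
        Satellites.tfp Rᵐᵒᵖ F →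
          Satellites.tfp Rᵐᵒᵖ ((Satellites.rightSatelliteIter _ _ n).obj F))
      (hleft : ∀ (n : ℕ) (F : ModuleCat.{u} Rᵐᵒᵖ ⥤+ AddCommGrpCat.{u}),
        Satellites.tfp Rᵐᵒᵖ F →
          Satellites.tfp Rᵐᵒᵖ ((Satellites.leftSatelliteIter _ _ n).obj F)),
      ∀ n : ℕ, Nonempty
        ((Satellites.tfp Rᵐᵒᵖ).lift
            ((Satellites.tfp Rᵐᵒᵖ).ι ⋙ Satellites.rightSatelliteIter _ _ n)
            (fun F => hright n F.obj F.property) ⊣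
          (Satellites.tfp Rᵐᵒᵖ).lift
            ((Satellites.tfp Rᵐᵒᵖ).ι ⋙ Satellites.leftSatelliteIter _ _ n)
            (fun F => hleft n F.obj F.property)) := by
  refine ⟨fun n F hF ↦ ?_, fun n F hF ↦ ?_, fun n ↦ ⟨?_⟩⟩
  · induction n with
    | zero => exact hF
    | succ n ih => exact Satellites.tfp_rightSatellite hR.1 ih
  · induction n with
    | zero => exact hF
    | succ n ih => exact Satellites.tfp_leftSatellite hR.2 ih
  -- The lifted functors commute with the inclusion on the nose, so identity isomorphisms suffice.
  · exact (Satellites.satelliteIterAdjunction _ _ n).restrictFullyFaithful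
      (Satellites.tfp Rᵐᵒᵖ).fullyFaithfulι (Satellites.tfp Rᵐᵒᵖ).fullyFaithfulι
      (Iso.refl _) (Iso.refl _)
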